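/- Let $\mathcal D$ be the law of a triple $(C,P,D)$ (production cost, retail price, demand) with values in $[0,1]^3$ such that: $\mathbb E[C]<\mathbb E[P]$; $D$ and $C$ are conditionally independent given $P$; for some $L>0$ the conditional distribution of $D$ given $P$ has a Lebesgue density with $f(d\mid p)>L$ for all $(p,d)\in[0,1]^2$; and the following stage game has a unique Stackelberg equilibrium $(w^\star,q^\star)$. In the stage game the supplier announces a wholesale price $w\ge 0$ and then the retailer orders a quantity $q\ge 0$; their utilities are $u_S(w,q)=qw-q\,\mathbb E[C]$ and $u_R(w,q)=\mathbb E[\min\{q,D\}P]-qw$; a Stackelberg equilibrium is a pair $(w^\star,q^\star)$ with $w^\star\in\arg\max_{w\ge0}u_S(w,\mathrm{BR}(w))$ and $q^\star=\mathrm{BR}(w^\star)$, where $\mathrm{BR}(w)\in\arg\max_{q\ge 0}u_R(w,q)$ for all $w\ge 0$. Write $\sigma(w;q,c)=qw-qc$ and $\rho(q;w,p,d)=\min\{q,d\}p-qw$. Let $(C_t,P_t,D_t)_{t\ge1}$ be i.i.d. with law $\mathcal D$ and put $M=\frac{1-\mathbb E[C]}{\mathbb E[P]\,L}+1$. For every horizon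 $T\ge1$, suppose that over rounds $t=1,\dots,T$ the supplier, who knows $\mathbb E[C]$, $L$ and $\mathbb E[P]$, runs the Piyavskii–Shubert algorithm with inputs $T$ and $M$, that is, $w_1=1$ and $$w_{t+1}\in\arg\max_{w\in[0,1]}\ \min_{1\le s\le t}\bigl\{q_s(w_s-\mathbb E[C])+M|w_s-w|\bigr\}\qquad(1\le t<T)$$ (with any choice of maximisers, possibly depending on $T$), and that the retailer best-responds, $q_t\in\arg\max_{q\in[0,1]}u_R(w_t,q)$. Then for every $T\ge 1$ $$\mathbb E[\sigma(w^\star;q^\star,C)]-\frac1T\sum_{t=1}^T\mathbb E[\sigma(w_t;q_t,C_t)]\le 2M\,\frac{\ln(4T)}{T}.$$ Moreover, $$\lim_{T\to\infty}\Bigl(\mathbb E[\rho(q^\star;w^\star,P,D)]-\frac1T\sum_{t=1}^T\mathbb E[\rho(q_t;w_t,P_t,D_t)]\Bigr)=0\quad\text{and}\quad\lim_{T\to\infty}\bigl(|w^\star-w_T|+|q^\star-q_T|\bigr)=0 .$$ -/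

import Mathlib

open MeasureTheory ProbabilityTheory Filter Topology Set

noncomputable section

namespace SupplyChain

/-- A realisation `(c, p, d)` of production cost, retail price and demand. -/
abbrev Outcome : Type := ℝ × ℝ × ℝ

/-- The production cost `C`. -/
def cost (x : Outcome) : ℝ := x.1

/-- The retail price `P`. -/
def price (x : Outcome) : ℝ := x.2.1

/-- The demand `D`. -/
def demand (x : Outcome) : ℝ := x.2.2

lemma measurable_cost : Measurable cost := measurable_fst

lemma measurable_price : Measurable price := measurable_fst.comp measurable_snd

lemma measurable_demand : Measurable demand := measurable_snd.comp measurable_snd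

/-- The supplier's one-round utility `σ(w; q, c) = q w - q c`. -/
def sigma (w q c : ℝ) : ℝ := q * w - q * c

/-- The retailer's one-round utility `ρ(q; w, p, d) = min{q, d} p - q w`. -/
def rho (q w p d : ℝ) : ℝ := min q d * p - q * w

/-- The supplier's expected utility `u_S(w, q)` in the stage game. -/
def uS (μ : Measure Outcome) (w q : ℝ) : ℝ := q * w - q * ∫ x, cost x ∂μ

/-- The retailer's expected utility `u_R(w, q)` in the stage game. -/
def uR (μ : Measure Outcome) (w q : ℝ) : ℝ :=
  (∫ x, min q (demand x) * price x ∂μ) - q * w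

/-- `(w, q)` is a Stackelberg equilibrium of the stage game with action sets `[0, ∞)`: for some
best-response map `BR` of the retailer, `w` maximises `v ↦ u_S(v, BR v)` and `q = BR w`. -/
def IsStackelberg (μ : Measure Outcome) (s : ℝ × ℝ) : Prop :=
  ∃ BR : ℝ → ℝ,
    (∀ v ∈ Ici (0 : ℝ), BR v ∈ Ici (0 : ℝ) ∧ IsMaxOn (uR μ v) (Ici 0) (BR v)) ∧
    s.1 ∈ Ici (0 : ℝ) ∧ IsMaxOn (fun v => uS μ v (BR v)) (Ici 0) s.1 ∧ s.2 = BR s.1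

/-- The assumptions on the law `μ` of `(C, P, D)` and on the constant `L`. -/
structure Admissible (μ : Measure Outcome) [IsProbabilityMeasure μ] (L : ℝ) : Prop where
  /-- `(C, P, D)` takes values in the unit cube. -/
  bounded : ∀ᵐ x ∂μ, cost x ∈ Icc (0 : ℝ) 1 ∧ price x ∈ Icc (0 : ℝ) 1 ∧
    demand x ∈ Icc (0 : ℝ) 1
  /-- `E[C] < E[P]`. -/
  cost_lt_price : ∫ x, cost x ∂μ < ∫ x, price x ∂μ
  /-- `D` and `C` are conditionally independent given `P`. -/
  condIndep : CondIndepFun (MeasurableSpace.comap price inferInstance)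
    measurable_price.comap_le demand cost μ
  L_pos : 0 < L
  /-- The conditional law of `D` given `P = p` has a Lebesgue density `f(· | p)` on `[0, 1]`,
  and `f(d | p) > L` for all `(p, d)` in the unit square. -/
  density : ∃ f : ℝ → ℝ → ℝ, Measurable (Function.uncurry f) ∧
    (∀ p ∈ Icc (0 : ℝ) 1, ∀ d ∈ Icc (0 : ℝ) 1, L < f p d) ∧
    ∀ᵐ p ∂(μ.map price), condDistrib demand price μ p =
      (volume.restrict (Icc (0 : ℝ) 1)).withDensity (fun d => ENNReal.ofReal (f p d))
  /-- The stage game has a unique Stackelberg equilibrium. -/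
  unique_equilibrium : ∃! s : ℝ × ℝ, IsStackelberg μ s

/-- The proxy after `t ≥ 1` rounds:
`x ↦ min_{1 ≤ s ≤ t} (q_s (w_s - E[C]) + M |w_s - x|)`, where `c` stands for `E[C]`. -/
def proxy (c M : ℝ) (w q : ℕ → ℝ) (t : ℕ) (ht : 1 ≤ t) (x : ℝ) : ℝ :=
  (Finset.Icc 1 t).inf' (Finset.nonempty_Icc.2 ht)
    (fun s => q s * (w s - c) + M * |w s - x|)

/-- `w 1, …, w T` are the wholesale prices selected in a run of the Piyavskii–Shubert algorithm
with horizon `T` and Lipschitz constant `M` (for some choice of the maximisers), when the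
observed quantities are `q 1, …, q T`. Rounds are numbered from `1`. -/
structure IsPiyavskiiShubertRun (c M : ℝ) (T : ℕ) (w q : ℕ → ℝ) : Prop where
  init : w 1 = 1
  step : ∀ (t : ℕ) (ht : 1 ≤ t), t < T →
    w (t + 1) ∈ Icc (0 : ℝ) 1 ∧ IsMaxOn (proxy c M w q t ht) (Icc 0 1) (w (t + 1))

/-- In rounds `1, …, T` the retailer's quantity in `[0, 1]` is a best response to the current
wholesale price. -/
def RetailerBestResponds (μ : Measure Outcome) (T : ℕ) (w q : ℕ → ℝ) : Prop :=
  ∀ t ∈ Finset.Icc 1 T, q t ∈ Icc (0 : ℝ) 1 ∧ IsMaxOn (uR μ (w t)) (Icc 0 1) (q t)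

end SupplyChain

end

/-!
Write `φ(x) = q(x) (x - E[C])` for the supplier's expected utility when the retailer best-responds
to the wholesale price `x`.

**The retailer.** The conditional law of `D` given `P` dominates `L` times Lebesgue measure on
`[0, 1]`, so `E[P h(D)] ≥ E[P] L ∫₀¹ h` for every `h ≥ 0` (`Admissible.integral_mul_price_ge`).
Applied to the concavity defect of `q ↦ min q d`, this makes the retailer's utility strongly
concave on `[0, 1]` with modulus `E[P] L`. Hence the best response `q(x)` is unique,
nonincreasing, and Lipschitz with constant `1 / (E[P] L)`.

**The supplier.** The equilibrium price lies in `(E[C], 1]` and, by uniqueness of the equilibrium,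
is the only maximiser of `φ` on `[0, 1]` (`IsStackelberg.exists_bestResponseMap`). When `E[C]` is
large, `φ` need not be `M`-Lipschitz on `[0, E[C]]`, but `φ(w*) - φ(x) < M |x - w*|` holds for all
`x ≠ w*` in `[0, 1]` (`IsBestResponseMap.isShubertObjective`). This one-point inequality says that
every cone of the proxy passes strictly above `φ(w*)` at `w*`, unless its apex is `w*` itself.

**Regret.** Consequently the maximum of the proxy is always strictly above `φ(w*)`, and any two
iterates satisfy `min (Δ_s, Δ_t) ≤ M |w_s - w_t|`, where `Δ_t = φ(w*) - φ(w_t)`. Among `n + 1`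
points of `[0, 1]` the smallest gap is thus at most `M / n`; discarding the points in increasing
order of their gaps bounds the total gap by `M` times one plus a harmonic number
(`sum_le_mul_one_add_harmonic`). The retailer's equilibrium payoff is a continuous function of the
price, and a continuous function deviates from its value at `w*` by at most `ε + K_ε Δ`, so its
average along the run converges (`tendsto_average`).

**Last iterate.** Separation only bounds the number of bad rounds, not when they occur, and runs
with different horizons may break ties differently. Suppose the last iterates cluster at some
`z ≠ w*` along an ultrafilter `U`. A maximiser of the proxy is `0`, `1` or a crossing of two cones, so
given the past it has finitely many possible values; hence each fixed round is `U`-eventually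
constant, and these constants form an infinite run. The cones of that run have infimum at most
`φ(w*)` everywhere, while at `z` they all stay at or above `φ(w*)`. As the cones of bad points are
the only ones that matter near `z`, and there are finitely many, some cone on each side of `z`
takes exactly the value `φ(w*)` at `z` (`exists_cone_eq_max`). But at the last iterates both cones
exceed `φ(w*)`, strictly, and no point near `z` has this property (`eq_of_tendsto_last`).
-/

namespace SupplyChain

/-! ### Separated points in the unit interval -/

/-- Packing in `[0, 1]`: if `n` points had spacing `δ > 1 / (n - 1)`, two of them would share one
of the cells `[k δ, (k + 1) δ)`. -/
theorem card_sub_one_mul_le_one {ι : Type*} (S : Finset ι) (w : ι → ℝ) {δ : ℝ} (hδ : 0 < δ)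
    (hw : ∀ s ∈ S, w s ∈ Icc (0 : ℝ) 1)
    (hsep : ∀ s ∈ S, ∀ t ∈ S, s ≠ t → δ ≤ |w s - w t|) :
    ((S.card : ℝ) - 1) * δ ≤ 1 := by
  by_contra! hlt
  have hmaps : ∀ s ∈ S, ⌊w s / δ⌋₊ ∈ Finset.range (S.card - 1) := by
    intro s hs
    have h1 : w s / δ < (S.card : ℝ) - 1 := by
      rw [div_lt_iff₀ hδ]; linarith [(hw s hs).2]
    have h2 : (1 : ℕ) ≤ S.card := Finset.card_pos.2 ⟨s, hs⟩
    rw [Finset.mem_range, Nat.floor_lt (div_nonneg (hw s hs).1 hδ.le)]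
    rwa [Nat.cast_sub h2, Nat.cast_one]
  have hpos : 0 < S.card := by
    rcases Nat.eq_zero_or_pos S.card with h | h
    · rw [h] at hlt; push_cast at hlt; linarith
    · exact h
  obtain ⟨s, hs, t, ht, hst, heq⟩ := Finset.exists_ne_map_eq_of_card_lt_of_maps_to
    (by rw [Finset.card_range]; omega) hmaps
  have hs1 := Nat.floor_le (div_nonneg (hw s hs).1 hδ.le)
  have hs2 := Nat.lt_floor_add_one (w s / δ)
  have ht1 := Nat.floor_le (div_nonneg (hw t ht).1 hδ.le)
  have ht2 := Nat.lt_floor_add_one (w t / δ)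
  rw [heq] at hs1 hs2
  have h3 : |w s / δ - w t / δ| < 1 := by rw [abs_lt]; constructor <;> linarith
  rw [← sub_div, abs_div, abs_of_pos hδ, div_lt_one hδ] at h3
  exact absurd (hsep s hs t ht hst) (not_le.2 h3)

/-- If points in `[0, 1]` repel each other at distance at least `1 / M` times the smaller of their
gaps, the gaps sum to at most `M (1 + H_n)`: the smallest of `n + 2` gaps is at most `M / (n +
1)`, and the point attaining it is removed. -/
theorem sum_le_mul_one_add_harmonic {ι : Type*} [DecidableEq ι] {M : ℝ} (hM : 0 < M)
    (w gap : ι → ℝ) (n : ℕ) :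
    ∀ S : Finset ι, S.card = n + 1 → (∀ s ∈ S, w s ∈ Icc (0 : ℝ) 1) → (∀ s ∈ S, gap s ≤ M) →
    (∀ s ∈ S, ∀ t ∈ S, s ≠ t → min (gap s) (gap t) ≤ M * |w s - w t|) →
    ∑ s ∈ S, gap s ≤ M * (1 + harmonic n) := by
  induction n with
  | zero =>
    intro S hS _ hgap _
    obtain ⟨a, rfl⟩ := Finset.card_eq_one.1 hS
    simpa using hgap a (by simp)
  | succ n ih =>
    intro S hS hw hgap hsep
    obtain ⟨a, ha, hmin⟩ := S.exists_min_image gap (Finset.card_pos.1 (by omega))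
    have hrec := ih (S.erase a) (by rw [Finset.card_erase_of_mem ha]; omega)
      (fun s hs => hw s (Finset.mem_of_mem_erase hs))
      (fun s hs => hgap s (Finset.mem_of_mem_erase hs))
      (fun s hs t ht => hsep s (Finset.mem_of_mem_erase hs) t (Finset.mem_of_mem_erase ht))
    have hga : gap a ≤ M * ((n : ℝ) + 1)⁻¹ := by
      rcases le_or_gt (gap a) 0 with h0 | h0
      · exact h0.trans (by positivity)
      · have h := card_sub_one_mul_le_one S w (div_pos h0 hM) hw (fun s hs t ht hst => by
          rw [div_le_iff₀' hM]
          exact (le_min (hmin s hs) (hmin t ht)).trans (hsep s hs t ht hst))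
        rw [hS] at h
        push_cast at h
        rw [← div_eq_mul_inv, le_div_iff₀ (by positivity)]
        rw [← mul_div_assoc, div_le_one hM] at h
        linarith
    rw [← Finset.add_sum_erase S gap ha, harmonic_succ]
    push_cast
    linarith

/-! ### Runs of the Piyavskii–Shubert algorithm -/

/-- The upper cone `x ↦ φ(y) + M |y - x|` with apex at an evaluated point `y`. The proxy of the
Piyavskii–Shubert algorithm is the minimum of these cones. -/
def cone (φ : ℝ → ℝ) (M y x : ℝ) : ℝ := φ y + M * |y - x|

/-- A run of length `T` of the Piyavskii–Shubert algorithm for an objective `φ` on `[0, 1]`.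
That `w (t + 1)` maximises the minimum of the cones at `w 1, …, w t` is phrased through strict lower
bounds: a number strictly below all cones at some point of `[0, 1]` is strictly below all cones at
`w (t + 1)`. The starting point is any point of `[0, 1]`. -/
structure IsShubertRun (φ : ℝ → ℝ) (M : ℝ) (T : ℕ) (w : ℕ → ℝ) : Prop where
  mem : ∀ t, 1 ≤ t → t ≤ T → w t ∈ Icc (0 : ℝ) 1
  step : ∀ t, 1 ≤ t → t < T → ∀ x ∈ Icc (0 : ℝ) 1, ∀ a : ℝ,
    (∀ s ∈ Finset.Icc 1 t, a < cone φ M (w s) x) →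
      ∀ s ∈ Finset.Icc 1 t, a < cone φ M (w s) (w (t + 1))

/-- The standing assumptions on an objective `φ` on `[0, 1]`: it is continuous, `xs` is its unique
maximiser, and the cone inequality at `xs` holds strictly. Neither a Lipschitz condition between two
arbitrary points, nor regularity off `[0, 1]`, is required. -/
structure IsShubertObjective (φ : ℝ → ℝ) (M xs : ℝ) : Prop where
  M_pos : 0 < M
  xs_mem : xs ∈ Ioc (0 : ℝ) 1
  cont : ContinuousOn φ (Icc 0 1)
  lt_max : ∀ x ∈ Icc (0 : ℝ) 1, x ≠ xs → φ x < φ xs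
  lt_cone : ∀ x ∈ Icc (0 : ℝ) 1, x ≠ xs → φ xs - φ x < M * |x - xs|

section Objective

variable {φ : ℝ → ℝ} {M xs : ℝ} {T : ℕ} {w : ℕ → ℝ}

theorem continuous_cone (φ : ℝ → ℝ) (M y : ℝ) : Continuous (cone φ M y) := by
  unfold cone; fun_prop

theorem IsShubertObjective.le_max (h : IsShubertObjective φ M xs) {x : ℝ}
    (hx : x ∈ Icc (0 : ℝ) 1) : φ x ≤ φ xs := by
  rcases eq_or_ne x xs with rfl | hne
  · exact le_rfl
  · exact (h.lt_max x hx hne).le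

theorem IsShubertObjective.max_sub_le (h : IsShubertObjective φ M xs) {x : ℝ}
    (hx : x ∈ Icc (0 : ℝ) 1) : φ xs - φ x ≤ M := by
  rcases eq_or_ne x xs with rfl | hne
  · simpa using h.M_pos.le
  · refine (h.lt_cone x hx hne).le.trans ?_
    have h1 : |x - xs| ≤ 1 := by
      rw [abs_le]; constructor <;> linarith [hx.1, hx.2, h.xs_mem.1, h.xs_mem.2]
    nlinarith [h.M_pos]

/-- The maximum of the proxy exceeds `φ xs` strictly, even when `xs` has been evaluated: the
witness is slightly to the left of `xs`. -/
theorem IsShubertObjective.exists_forall_lt_cone (h : IsShubertObjective φ M xs)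
    (S : Finset ℕ) (hw : ∀ s ∈ S, w s ∈ Icc (0 : ℝ) 1) :
    ∃ x ∈ Icc (0 : ℝ) 1, ∀ s ∈ S, φ xs < cone φ M (w s) x := by
  have h1 : ∀ᶠ x in 𝓝[<] xs, ∀ s ∈ S, φ xs < cone φ M (w s) x := by
    rw [Filter.eventually_all_finset]
    intro s hs
    rcases eq_or_ne (w s) xs with heq | hne
    · filter_upwards [self_mem_nhdsWithin] with x hx
      have : 0 < |xs - x| := abs_pos.2 (sub_ne_zero.2 (ne_of_gt hx))
      rw [cone, heq]
      nlinarith [h.M_pos]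
    · have : φ xs < cone φ M (w s) xs := by
        have := h.lt_cone _ (hw s hs) hne
        rw [cone]; linarith
      exact nhdsWithin_le_nhds ((continuous_cone φ M (w s)).continuousAt.eventually_const_lt this)
  have h2 : ∀ᶠ x in 𝓝[<] xs, x ∈ Icc (0 : ℝ) 1 := by
    filter_upwards [Ioo_mem_nhdsLT h.xs_mem.1] with x hx
    exact ⟨hx.1.le, hx.2.le.trans h.xs_mem.2⟩
  obtain ⟨x, hx1, hx2⟩ := (h1.and h2).exists
  exact ⟨x, hx2, hx1⟩

/-- The separation inequality: a point is never selected within `(φ xs - φ (w s)) / M` of an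
earlier one. -/
theorem IsShubertRun.max_lt_cone (h : IsShubertObjective φ M xs) (hw : IsShubertRun φ M T w)
    {s t : ℕ} (hs : 1 ≤ s) (hst : s < t) (ht : t ≤ T) : φ xs < cone φ M (w s) (w t) := by
  obtain ⟨t, rfl⟩ : ∃ u, t = u + 1 := ⟨t - 1, by omega⟩
  obtain ⟨x, hx, hlt⟩ := h.exists_forall_lt_cone (w := w) (Finset.Icc 1 t) (fun r hr => by
    rw [Finset.mem_Icc] at hr
    exact hw.mem r hr.1 (by omega))
  exact hw.step t (by omega) (by omega) x hx _ hlt s (Finset.mem_Icc.2 ⟨hs, by omega⟩)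

theorem IsShubertRun.min_gap_le (h : IsShubertObjective φ M xs) (hw : IsShubertRun φ M T w)
    {s t : ℕ} (hs : s ∈ Finset.Icc 1 T) (ht : t ∈ Finset.Icc 1 T) (hst : s ≠ t) :
    min (φ xs - φ (w s)) (φ xs - φ (w t)) ≤ M * |w s - w t| := by
  rw [Finset.mem_Icc] at hs ht
  rcases lt_or_gt_of_ne hst with hlt | hlt
  · have := hw.max_lt_cone h hs.1 hlt ht.2
    rw [cone] at this
    exact (min_le_left _ _).trans (by linarith)
  · have := hw.max_lt_cone h ht.1 hlt hs.2
    rw [cone, abs_sub_comm] at this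
    exact (min_le_right _ _).trans (by linarith)

/-- The logarithmic bound on the cumulative regret of a run. -/
theorem IsShubertRun.sum_gap_le (h : IsShubertObjective φ M xs) (hw : IsShubertRun φ M T w)
    (hT : 1 ≤ T) :
    ∑ t ∈ Finset.Icc 1 T, (φ xs - φ (w t)) ≤ 2 * M * Real.log (4 * (T : ℝ)) := by
  have hmem : ∀ t ∈ Finset.Icc 1 T, w t ∈ Icc (0 : ℝ) 1 := fun t ht =>
    hw.mem t (Finset.mem_Icc.1 ht).1 (Finset.mem_Icc.1 ht).2
  refine (sum_le_mul_one_add_harmonic h.M_pos w (fun t => φ xs - φ (w t)) (T - 1)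
    (Finset.Icc 1 T) (by simp; omega) hmem (fun t ht => h.max_sub_le (hmem t ht))
    (fun s hs t ht hst => hw.min_gap_le h hs ht hst)).trans ?_
  have hT0 : (1 : ℝ) ≤ T := by exact_mod_cast hT
  have hlog : Real.log ((T - 1 : ℕ) : ℝ) ≤ Real.log T := by
    rcases Nat.eq_zero_or_pos (T - 1) with h0 | h0
    · rw [h0]; simpa using Real.log_nonneg hT0
    · exact Real.log_le_log (by exact_mod_cast h0) (by exact_mod_cast Nat.sub_le T 1)
  have hH : ((harmonic (T - 1) : ℚ) : ℝ) ≤ 1 + Real.log T :=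
    (harmonic_le_one_add_log (T - 1)).trans (by linarith)
  have h4 : 1 ≤ Real.log 4 := by
    rw [show (4 : ℝ) = 2 ^ 2 by norm_num, Real.log_pow]
    have := Real.log_two_gt_d9
    push_cast; linarith
  rw [Real.log_mul (by norm_num) (by linarith)]
  have := Real.log_nonneg hT0
  have hM := h.M_pos
  nlinarith

/-- A maximiser of the minimum of finitely many cones over `[0, 1]` is an endpoint or a point
where a rising and a falling cone cross. Hence it can take only finitely many values. -/
theorem eq_crossing_of_forall_lt_cone (hM : 0 < M) {S : Finset ℕ} {x : ℝ}
    (hx : x ∈ Icc (0 : ℝ) 1) (hS : S.Nonempty)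
    (hmax : ∀ y ∈ Icc (0 : ℝ) 1, ∀ a : ℝ,
      (∀ s ∈ S, a < cone φ M (w s) y) → ∀ s ∈ S, a < cone φ M (w s) x) :
    x = 0 ∨ x = 1 ∨ ∃ s ∈ S, ∃ r ∈ S,
      x = (φ (w r) - φ (w s) + M * (w r + w s)) / (2 * M) := by
  by_contra! hcon
  obtain ⟨hx0, hx1, hcross⟩ := hcon
  replace hx0 : 0 < x := lt_of_le_of_ne hx.1 (Ne.symm hx0)
  replace hx1 : x < 1 := lt_of_le_of_ne hx.2 hx1
  obtain ⟨s₀, hs₀, hmin⟩ := S.exists_min_image (fun s => cone φ M (w s) x) hS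
  -- Some cone that is active at `x` has its apex strictly to the right, for otherwise the minimum
  -- of the cones would increase to the right of `x`; likewise on the left.
  have hright : ∃ r ∈ S, cone φ M (w r) x = cone φ M (w s₀) x ∧ x < w r := by
    by_contra! hno
    have h1 : ∀ᶠ y in 𝓝[>] x, ∀ s ∈ S, cone φ M (w s₀) x < cone φ M (w s) y := by
      rw [Filter.eventually_all_finset]
      intro s hs
      rcases (hmin s hs).eq_or_lt with heq | hlt
      · have hle := hno s hs heq.symm
        filter_upwards [self_mem_nhdsWithin] with y (hy : x < y)
        rw [heq, cone, cone, abs_of_nonpos (by linarith), abs_of_nonpos (by linarith)]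
        nlinarith
      · exact nhdsWithin_le_nhds
          ((continuous_cone φ M (w s)).continuousAt.eventually_const_lt hlt)
    obtain ⟨y, hy1, hy2⟩ := (h1.and (Ioo_mem_nhdsGT hx1)).exists
    exact lt_irrefl _ (hmax y ⟨(hx0.trans hy2.1).le, hy2.2.le⟩ _ hy1 s₀ hs₀)
  have hleft : ∃ r ∈ S, cone φ M (w r) x = cone φ M (w s₀) x ∧ w r < x := by
    by_contra! hno
    have h1 : ∀ᶠ y in 𝓝[<] x, ∀ s ∈ S, cone φ M (w s₀) x < cone φ M (w s) y := by
      rw [Filter.eventually_all_finset]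
      intro s hs
      rcases (hmin s hs).eq_or_lt with heq | hlt
      · have hle := hno s hs heq.symm
        filter_upwards [self_mem_nhdsWithin] with y (hy : y < x)
        rw [heq, cone, cone, abs_of_nonneg (by linarith), abs_of_nonneg (by linarith)]
        nlinarith
      · exact nhdsWithin_le_nhds
          ((continuous_cone φ M (w s)).continuousAt.eventually_const_lt hlt)
    obtain ⟨y, hy1, hy2⟩ := (h1.and (Ioo_mem_nhdsLT hx0)).exists
    exact lt_irrefl _ (hmax y ⟨hy2.1.le, (hy2.2.trans hx1).le⟩ _ hy1 s₀ hs₀)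
  obtain ⟨r, hr, hreq, hrx⟩ := hright
  obtain ⟨l, hl, hleq, hlx⟩ := hleft
  refine hcross l hl r hr ?_
  have heq := hreq.trans hleq.symm
  rw [cone, cone, abs_of_pos (by linarith), abs_of_neg (by linarith)] at heq
  rw [eq_div_iff (by positivity)]
  linarith

theorem exists_eventually_eq_of_finite {α β : Type*} (U : Ultrafilter α) (f : α → β) {F : Set β}
    (hF : F.Finite) (h : ∀ᶠ a in (U : Filter α), f a ∈ F) :
    ∃ b, ∀ᶠ a in (U : Filter α), f a = b := by
  have h1 : (⋃ b ∈ F, f ⁻¹' {b}) ∈ U := by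
    filter_upwards [h] with a ha
    simpa using ha
  obtain ⟨b, -, hb⟩ := (Ultrafilter.finite_biUnion_mem_iff hF).1 h1
  exact ⟨b, hb⟩

/-- Along an ultrafilter of horizons, the price chosen in each fixed round is eventually constant,
however ties are broken. -/
theorem exists_eventually_eq_of_isShubertRun (hM : 0 < M) {w : ℕ → ℕ → ℝ}
    (hw : ∀ T, 1 ≤ T → IsShubertRun φ M T (w T)) (hinit : ∀ T, 1 ≤ T → w T 1 = 1)
    (U : Ultrafilter ℕ) (hU : (U : Filter ℕ) ≤ atTop) (t : ℕ) :
    ∃ v : ℕ → ℝ, ∀ s ∈ Finset.Icc 1 (t + 1), ∀ᶠ T in (U : Filter ℕ), w T s = v s := by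
  induction t with
  | zero =>
    refine ⟨fun _ => 1, fun s hs => ?_⟩
    obtain rfl : s = 1 := by simpa using hs
    filter_upwards [hU (eventually_ge_atTop 1)] with T hT using hinit T hT
  | succ t ih =>
    obtain ⟨v, hv⟩ := ih
    set S := Finset.Icc 1 (t + 1) with hS
    have hfin : ({0, 1} ∪ (fun p : ℕ × ℕ =>
        (φ (v p.2) - φ (v p.1) + M * (v p.2 + v p.1)) / (2 * M)) '' (S ×ˢ S : Finset (ℕ × ℕ)) :
          Set ℝ).Finite := (Set.toFinite _).union ((Finset.finite_toSet _).image _)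
    obtain ⟨b, hb⟩ := exists_eventually_eq_of_finite U (fun T => w T (t + 2)) hfin (by
      filter_upwards [hU (eventually_ge_atTop (t + 2)), (Filter.eventually_all_finset S).2 hv]
        with T hT hvT
      have hrun := hw T (by omega)
      rcases eq_crossing_of_forall_lt_cone (w := w T) (S := S) hM
          (hrun.mem (t + 2) (by omega) hT) (by simp [hS])
          (hrun.step (t + 1) (by omega) (by omega)) with h | h | ⟨s, hs, r, hr, h⟩
      · exact Or.inl (Or.inl h)
      · exact Or.inl (Or.inr h)
      · refine Or.inr ⟨(s, r), by simp [hs, hr], ?_⟩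
        rw [h, hvT s hs, hvT r hr])
    refine ⟨fun s => if s = t + 2 then b else v s, fun s hs => ?_⟩
    rw [Finset.mem_Icc] at hs
    rcases eq_or_ne s (t + 2) with rfl | hne
    · simpa using hb
    · simpa [hne] using hv s (Finset.mem_Icc.2 ⟨hs.1, by omega⟩)

/-! ### Convergence of the last iterate and of averages -/

/-- An infinite run visits points with gap at least `η` finitely often. -/
theorem finite_setOf_le_gap (h : IsShubertObjective φ M xs) {v : ℕ → ℝ}
    (hv : ∀ T, IsShubertRun φ M T v) {η : ℝ} (hη : 0 < η) :
    {s : ℕ | 1 ≤ s ∧ η ≤ φ xs - φ (v s)}.Finite := by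
  by_contra hinf
  obtain ⟨n, hn⟩ := exists_nat_gt (M / η + 1)
  obtain ⟨S, hS, hcard⟩ := Set.Infinite.exists_subset_card_eq hinf n
  have hpack := card_sub_one_mul_le_one S v (div_pos hη h.M_pos)
    (fun s hs => (hv s).mem s (hS hs).1 le_rfl) (fun s hs t ht hst => by
      rw [div_le_iff₀' h.M_pos]
      refine (le_min (hS hs).2 (hS ht).2).trans ((hv (max s t)).min_gap_le h ?_ ?_ hst)
      · exact Finset.mem_Icc.2 ⟨(hS hs).1, le_max_left _ _⟩
      · exact Finset.mem_Icc.2 ⟨(hS ht).1, le_max_right _ _⟩)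
  rw [hcard, ← mul_div_assoc, div_le_one h.M_pos, ← le_div_iff₀ hη] at hpack
  linarith

/-- Along an infinite run the proxy decreases to at most `φ xs` at every point of `[0, 1]`: a
proxy with maximum at least `φ xs + η` forces all iterates to be separated by a fixed distance. -/
theorem exists_cone_lt (h : IsShubertObjective φ M xs) {v : ℕ → ℝ}
    (hv : ∀ T, IsShubertRun φ M T v) {x : ℝ} (hx : x ∈ Icc (0 : ℝ) 1) {η : ℝ} (hη : 0 < η) :
    ∃ s, 1 ≤ s ∧ cone φ M (v s) x < φ xs + η := by
  by_contra! hno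
  have hmem : ∀ s, 1 ≤ s → v s ∈ Icc (0 : ℝ) 1 := fun s hs => (hv s).mem s hs le_rfl
  have hlt : ∀ s t, 1 ≤ s → s < t → η / 2 ≤ M * |v s - v t| := by
    intro s t hs hst
    obtain ⟨t, rfl⟩ : ∃ u, t = u + 1 := ⟨t - 1, by omega⟩
    have h1 := (hv (t + 1)).step t (by omega) (by omega) x hx (φ xs + η / 2)
      (fun r hr => by linarith [hno r (Finset.mem_Icc.1 hr).1]) s
      (Finset.mem_Icc.2 ⟨hs, by omega⟩)
    rw [cone] at h1
    linarith [h.le_max (hmem s hs)]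
  obtain ⟨n, hn⟩ := exists_nat_gt (M / (η / 2) + 1)
  have hpack := card_sub_one_mul_le_one (Finset.Icc 1 n) v (div_pos (half_pos hη) h.M_pos)
    (fun s hs => hmem s (Finset.mem_Icc.1 hs).1) (fun s hs t ht hst => by
      rw [div_le_iff₀' h.M_pos]
      rcases lt_or_gt_of_ne hst with hlt' | hlt'
      · exact hlt s t (Finset.mem_Icc.1 hs).1 hlt'
      · rw [abs_sub_comm]; exact hlt t s (Finset.mem_Icc.1 ht).1 hlt')
  rw [Nat.card_Icc, Nat.add_sub_cancel, ← mul_div_assoc, div_le_one h.M_pos,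
    ← le_div_iff₀ (half_pos hη)] at hpack
  linarith

/-- Suppose the iterates of an infinite run stay away from `z`, and all cones are at least `φ xs`
at `z`. Then, on each side of `z` (selected by the sign `e`) on which `[0, 1]` extends beyond `z`,
some iterate has a cone with value exactly `φ xs` at `z`. Such cones are what keeps the proxy at
most `φ xs` on that side. -/
theorem exists_cone_eq_max (h : IsShubertObjective φ M xs) {v : ℕ → ℝ}
    (hv : ∀ T, IsShubertRun φ M T v) {z : ℝ} {δ : ℝ} (hδ : 0 < δ)
    (hfar : ∀ s, 1 ≤ s → δ ≤ |v s - z|) (hcone : ∀ s, 1 ≤ s → φ xs ≤ cone φ M (v s) z)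
    {e : ℝ} (he : e = 1 ∨ e = -1) (hz : ∀ᶠ y in 𝓝[>] (0 : ℝ), z + e * y ∈ Icc (0 : ℝ) 1) :
    ∃ r, 1 ≤ r ∧ 0 < e * (v r - z) ∧ cone φ M (v r) z = φ xs := by
  by_contra! hno
  have hM := h.M_pos
  set F := {s : ℕ | 1 ≤ s ∧ M * δ / 2 ≤ φ xs - φ (v s)} with hF
  have hfin : F.Finite := finite_setOf_le_gap h hv (by positivity)
  have h1 : ∀ᶠ y in 𝓝[>] (0 : ℝ), ∀ s ∈ F, 0 < e * (v s - z) →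
      φ xs + 2 * M * y < cone φ M (v s) z := by
    rw [Filter.eventually_all_finite hfin]
    intro s hs
    by_cases hpos : 0 < e * (v s - z)
    · have hlt : φ xs + 2 * M * 0 < cone φ M (v s) z := by
        simpa using lt_of_le_of_ne (hcone s hs.1) (hno s hs.1 hpos).symm
      have hc : ContinuousAt (fun y : ℝ => φ xs + 2 * M * y) 0 := by fun_prop
      exact nhdsWithin_le_nhds ((hc.eventually_lt_const hlt).mono fun y hy _ => hy)
    · exact Eventually.of_forall fun y hp => absurd hp hpos
  obtain ⟨y, ⟨hy1, hy2⟩, hy0, hyδ⟩ :=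
    ((h1.and hz).and (Ioo_mem_nhdsGT (show (0 : ℝ) < δ / 4 by positivity))).exists
  obtain ⟨s, hs, hlt⟩ := exists_cone_lt h hv hy2 (mul_pos hM hy0)
  have hMy : 0 < M * y := mul_pos hM hy0
  have hey : |e * y| = y := by
    rcases he with rfl | rfl <;> simp [abs_of_pos hy0]
  have htri : |v s - z| ≤ |v s - (z + e * y)| + y := by
    calc |v s - z| = |(v s - (z + e * y)) + e * y| := by congr 1; ring
      _ ≤ _ := by rw [← hey]; simpa [hey] using abs_add_le (v s - (z + e * y)) (e * y)
  have hlt2 : cone φ M (v s) z < φ xs + 2 * M * y := by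
    rw [cone] at hlt ⊢
    nlinarith
  have hsF : s ∈ F := by
    refine ⟨hs, ?_⟩
    rw [cone] at hlt2
    nlinarith [mul_le_mul_of_nonneg_left (hfar s hs) hM.le, mul_lt_mul_of_pos_left hyδ hM]
  by_cases hpos : 0 < e * (v s - z)
  · exact absurd (hy1 s hsF hpos) (not_lt.2 hlt2.le)
  · -- From an apex on the other side of `z` the cone rises by `M * y` between `z` and `z + e * y`.
    have habs : |v s - (z + e * y)| = |v s - z| + y := by
      rcases he with rfl | rfl
      · rw [abs_of_nonpos (by linarith), abs_of_nonpos (by linarith)]; ring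
      · rw [abs_of_nonneg (by linarith), abs_of_nonneg (by linarith)]; ring
    have := hcone s hs
    rw [cone, habs] at hlt
    rw [cone] at this
    linarith

/-- A cluster point of the last iterates is the maximiser. -/
theorem eq_of_tendsto_last (h : IsShubertObjective φ M xs) {w : ℕ → ℕ → ℝ}
    (hw : ∀ T, 1 ≤ T → IsShubertRun φ M T (w T)) (hinit : ∀ T, 1 ≤ T → w T 1 = 1)
    (U : Ultrafilter ℕ) (hU : (U : Filter ℕ) ≤ atTop) {z : ℝ} (hz : z ∈ Icc (0 : ℝ) 1)
    (hlim : Tendsto (fun T => w T T) U (𝓝 z)) : z = xs := by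
  by_contra hne
  have hM := h.M_pos
  have hex : ∀ s : ℕ, ∃ y : ℝ, 1 ≤ s → ∀ᶠ T in (U : Filter ℕ), w T s = y := by
    intro s
    obtain ⟨v, hv⟩ := exists_eventually_eq_of_isShubertRun hM hw hinit U hU s
    exact ⟨v s, fun hs => hv s (Finset.mem_Icc.2 ⟨hs, by omega⟩)⟩
  choose v hv using hex
  have hvrun : ∀ T, IsShubertRun φ M T v := by
    refine fun T => ⟨fun t ht _ => ?_, fun t ht _ => ?_⟩
    · obtain ⟨N, hN, hNt⟩ := ((hv t ht).and (hU (eventually_ge_atTop t))).exists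
      rw [← hN]
      exact (hw N (by omega)).mem t ht hNt
    · have hall : ∀ᶠ N in (U : Filter ℕ), ∀ s ∈ Finset.Icc 1 (t + 1), w N s = v s :=
        (Filter.eventually_all_finset _).2 fun s hs => hv s (Finset.mem_Icc.1 hs).1
      obtain ⟨N, hN, hNt⟩ := (hall.and (hU (eventually_ge_atTop (t + 1)))).exists
      have hsub : ∀ s ∈ Finset.Icc 1 t, w N s = v s := fun s hs =>
        hN s (Finset.Icc_subset_Icc le_rfl (Nat.le_succ t) hs)
      intro x hx a ha s hs
      rw [← hsub s hs, ← hN (t + 1) (by simp)]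
      exact (hw N (by omega)).step t ht (by omega) x hx a
        (fun r hr => by rw [hsub r hr]; exact ha r hr) s hs
  have hlast : ∀ s, 1 ≤ s → ∀ᶠ T in (U : Filter ℕ), φ xs < cone φ M (v s) (w T T) := by
    intro s hs
    filter_upwards [hv s hs, hU (eventually_gt_atTop s)] with T hT hsT
    rw [← hT]
    exact (hw T (by omega)).max_lt_cone h hs hsT le_rfl
  have hcone : ∀ s, 1 ≤ s → φ xs ≤ cone φ M (v s) z := fun s hs =>
    ge_of_tendsto (((continuous_cone φ M (v s)).tendsto z).comp hlim)
      ((hlast s hs).mono fun _ hT => hT.le)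
  -- Near `z` the gap is bounded below, and a point with a large gap repels `z`.
  obtain ⟨δ, hδ, hfar⟩ : ∃ δ > 0, ∀ s, 1 ≤ s → δ ≤ |v s - z| := by
    have hgap := h.lt_max z hz hne
    obtain ⟨ρ, hρ, hnear⟩ := Metric.continuousWithinAt_iff.1 (h.cont z hz)
      ((φ xs - φ z) / 2) (by linarith)
    refine ⟨min ρ ((φ xs - φ z) / (2 * M)), lt_min hρ (div_pos (by linarith) (by positivity)),
      fun s hs => ?_⟩
    by_contra! hlt
    have h1 := hnear ((hvrun s).mem s hs le_rfl) (by
      rw [Real.dist_eq]; exact hlt.trans_le (min_le_left _ _))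
    rw [Real.dist_eq, abs_lt] at h1
    have h2 := hcone s hs
    have h3 := hlt.trans_le (min_le_right _ _)
    rw [lt_div_iff₀ (by positivity)] at h3
    rw [cone] at h2
    linarith [h1.2]
  have hmem : ∀ᶠ T in (U : Filter ℕ), w T T ∈ Icc (0 : ℝ) 1 := by
    filter_upwards [hU (eventually_ge_atTop 1)] with T hT using (hw T hT).mem T hT le_rfl
  rcases lt_or_eq_of_le hz.2 with hz1 | hz1
  · have hright : ∀ᶠ T in (U : Filter ℕ), w T T < z := by
      obtain ⟨r, hr, hpos, heq⟩ := exists_cone_eq_max h hvrun hδ hfar hcone (Or.inl rfl) (by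
        filter_upwards [Ioo_mem_nhdsGT (show (0 : ℝ) < 1 - z by linarith)] with y hy
        constructor <;> linarith [hy.1, hy.2, hz.1])
      filter_upwards [hlast r hr, hlim.eventually_lt_const (show z < v r by linarith)]
        with T hT hTr
      rw [← heq, cone, cone, abs_of_pos (by linarith), abs_of_pos (by linarith)] at hT
      nlinarith
    have hleft : ∀ᶠ T in (U : Filter ℕ), z ≤ w T T := by
      rcases hz.1.eq_or_lt with hz0 | hz0
      · filter_upwards [hmem] with T hT using hz0 ▸ hT.1
      · obtain ⟨r, hr, hpos, heq⟩ := exists_cone_eq_max h hvrun hδ hfar hcone (Or.inr rfl) (by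
          filter_upwards [Ioo_mem_nhdsGT hz0] with y hy
          constructor <;> linarith [hy.1, hy.2, hz.2])
        filter_upwards [hlast r hr, hlim.eventually_const_lt (show v r < z by linarith)]
          with T hT hTr
        rw [← heq, cone, cone, abs_of_neg (by linarith), abs_of_neg (by linarith)] at hT
        nlinarith
    obtain ⟨T, h1, h2⟩ := (hright.and hleft).exists
    exact absurd h1 (not_lt.2 h2)
  · -- The first evaluated point is `1`, so `z = 1` is excluded by `hfar`.
    have hv1 : v 1 = 1 := by
      obtain ⟨T, hT, hT1⟩ := ((hv 1 le_rfl).and (hU (eventually_ge_atTop 1))).exists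
      rw [← hT, hinit T hT1]
    have := hfar 1 le_rfl
    rw [hv1, hz1, sub_self, abs_zero] at this
    exact absurd this (not_le.2 hδ)

/-- The last iterates of runs with growing horizons converge to the maximiser, even though the
runs are unrelated to each other. -/
theorem tendsto_last_iterate (h : IsShubertObjective φ M xs) {w : ℕ → ℕ → ℝ}
    (hw : ∀ T, 1 ≤ T → IsShubertRun φ M T (w T)) (hinit : ∀ T, 1 ≤ T → w T 1 = 1) :
    Tendsto (fun T => w T T) atTop (𝓝 xs) := by
  rw [tendsto_iff_ultrafilter]
  intro U hU
  have hmem : ∀ᶠ T in (U : Filter ℕ), w T T ∈ Icc (0 : ℝ) 1 := by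
    filter_upwards [hU (eventually_ge_atTop 1)] with T hT using (hw T hT).mem T hT le_rfl
  obtain ⟨z, hz, hlim⟩ := isCompact_Icc.ultrafilter_le_nhds (U.map fun T => w T T)
    (le_principal_iff.2 hmem)
  rwa [eq_of_tendsto_last h hw hinit U hU hz hlim] at hlim

/-- The deviation of a continuous function from its value at the maximiser is controlled by the
gap, up to an additive `ε`: by compactness, a deviation of at least `ε` comes with a gap bounded
below. -/
theorem exists_abs_sub_le_add_mul_gap (h : IsShubertObjective φ M xs) {V : ℝ → ℝ}
    (hV : ContinuousOn V (Icc 0 1)) {ε : ℝ} (hε : 0 < ε) :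
    ∃ K, 0 ≤ K ∧ ∀ x ∈ Icc (0 : ℝ) 1, |V xs - V x| ≤ ε + K * (φ xs - φ x) := by
  have hcont : ContinuousOn (fun x => |V xs - V x|) (Icc 0 1) := (continuousOn_const.sub hV).abs
  obtain ⟨B, hB⟩ := isCompact_Icc.exists_bound_of_continuousOn hcont
  have hclosed : IsClosed (Icc (0 : ℝ) 1 ∩ (fun x => |V xs - V x|) ⁻¹' Ici ε) :=
    hcont.preimage_isClosed_of_isClosed isClosed_Icc isClosed_Ici
  have hcomp : IsCompact (Icc (0 : ℝ) 1 ∩ (fun x => |V xs - V x|) ⁻¹' Ici ε) :=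
    isCompact_Icc.of_isClosed_subset hclosed inter_subset_left
  rcases (Icc (0 : ℝ) 1 ∩ (fun x => |V xs - V x|) ⁻¹' Ici ε).eq_empty_or_nonempty with he | he
  · refine ⟨0, le_rfl, fun x hx => ?_⟩
    by_contra! hlt
    exact (Set.eq_empty_iff_forall_notMem.1 he) x ⟨hx, by simpa using hlt.le⟩
  · obtain ⟨y, ⟨hy, hyV⟩, hmax⟩ := hcomp.exists_isMaxOn he (h.cont.mono inter_subset_left)
    have hyne : y ≠ xs := by
      rintro rfl
      simp only [mem_preimage, sub_self, abs_zero, mem_Ici] at hyV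
      linarith
    have hgap := sub_pos.2 (h.lt_max y hy hyne)
    have hB0 : 0 ≤ B := (norm_nonneg _).trans (hB y hy)
    refine ⟨B / (φ xs - φ y), by positivity, fun x hx => ?_⟩
    rcases lt_or_ge (|V xs - V x|) ε with hlt | hge
    · have := mul_nonneg (div_nonneg hB0 hgap.le) (sub_nonneg.2 (h.le_max hx))
      linarith
    · have h1 : φ x ≤ φ y := hmax ⟨hx, hge⟩
      have h2 : |V xs - V x| ≤ B := by simpa using hB x hx
      have h3 : B = B / (φ xs - φ y) * (φ xs - φ y) := by field_simp
      have h4 : B / (φ xs - φ y) * (φ xs - φ y) ≤ B / (φ xs - φ y) * (φ xs - φ x) := by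
        gcongr
      linarith

theorem tendsto_average (h : IsShubertObjective φ M xs) {w : ℕ → ℕ → ℝ}
    (hw : ∀ T, 1 ≤ T → IsShubertRun φ M T (w T)) {V : ℝ → ℝ} (hV : ContinuousOn V (Icc 0 1)) :
    Tendsto (fun T : ℕ => V xs - (1 / (T : ℝ)) * ∑ t ∈ Finset.Icc 1 T, V (w T t)) atTop (𝓝 0) := by
  have hlog : Tendsto (fun T : ℕ => Real.log (4 * (T : ℝ)) / (T : ℝ)) atTop (𝓝 0) := by
    have h1 : Tendsto (fun x : ℝ => Real.log x / x) atTop (𝓝 0) :=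
      Real.isLittleO_log_id_atTop.tendsto_div_nhds_zero
    have h2 : Tendsto (fun T : ℕ => 4 * (T : ℝ)) atTop atTop :=
      tendsto_natCast_atTop_atTop.const_mul_atTop (by norm_num)
    have h3 := (h1.comp h2).const_mul 4
    rw [mul_zero] at h3
    refine h3.congr fun T => ?_
    simp only [Function.comp]
    rw [← mul_div_assoc, mul_div_mul_left _ _ (by norm_num)]
  rw [Metric.tendsto_nhds]
  intro ε hε
  obtain ⟨K, hK, hKV⟩ := exists_abs_sub_le_add_mul_gap h hV (half_pos hε)
  have h4 := hlog.const_mul (K * (2 * M))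
  rw [mul_zero] at h4
  filter_upwards [h4.eventually_lt_const (half_pos hε), eventually_ge_atTop 1] with T hT hT1
  have hT0 : (0 : ℝ) < T := by exact_mod_cast hT1
  rw [Real.dist_eq, sub_zero]
  have hrw : V xs - (1 / (T : ℝ)) * ∑ t ∈ Finset.Icc 1 T, V (w T t)
      = (1 / (T : ℝ)) * ∑ t ∈ Finset.Icc 1 T, (V xs - V (w T t)) := by
    rw [Finset.sum_sub_distrib, Finset.sum_const, Nat.card_Icc, Nat.add_sub_cancel, nsmul_eq_mul]
    field_simp
  have hsum : |∑ t ∈ Finset.Icc 1 T, (V xs - V (w T t))|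
      ≤ T * (ε / 2) + K * (2 * M * Real.log (4 * (T : ℝ))) := by
    calc |∑ t ∈ Finset.Icc 1 T, (V xs - V (w T t))|
        ≤ ∑ t ∈ Finset.Icc 1 T, |V xs - V (w T t)| := Finset.abs_sum_le_sum_abs _ _
      _ ≤ ∑ t ∈ Finset.Icc 1 T, (ε / 2 + K * (φ xs - φ (w T t))) :=
          Finset.sum_le_sum fun t ht => hKV _
            ((hw T hT1).mem t (Finset.mem_Icc.1 ht).1 (Finset.mem_Icc.1 ht).2)
      _ = T * (ε / 2) + K * ∑ t ∈ Finset.Icc 1 T, (φ xs - φ (w T t)) := by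
          rw [Finset.sum_add_distrib, Finset.sum_const, Nat.card_Icc, Nat.add_sub_cancel,
            nsmul_eq_mul, Finset.mul_sum]
      _ ≤ _ := by
          gcongr
          exact (hw T hT1).sum_gap_le h hT1
  rw [hrw, abs_mul, abs_of_pos (by positivity), one_div, inv_mul_lt_iff₀ hT0]
  refine hsum.trans_lt ?_
  rw [← mul_div_assoc, div_lt_iff₀ hT0] at hT
  linarith

end Objective

/-! ### The retailer's problem -/

section Game

variable {μ : Measure Outcome} [IsProbabilityMeasure μ] {L : ℝ}

theorem Admissible.ae_price_mem (hμ : Admissible μ L) :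
    ∀ᵐ p ∂(μ.map price), p ∈ Icc (0 : ℝ) 1 := by
  exact (ae_map_iff measurable_price.aemeasurable measurableSet_Icc).2
    (hμ.bounded.mono fun x hx => hx.2.1)

/-- The density bound, integrated against the price: the conditional law of the demand dominates
`L` times Lebesgue measure on `[0, 1]`. -/
theorem Admissible.lintegral_price_mul_ge (hμ : Admissible μ L) {h : ℝ → ENNReal}
    (hh : Measurable h) :
    ENNReal.ofReal L * (∫⁻ x, ENNReal.ofReal (price x) ∂μ) * ∫⁻ d in Icc (0 : ℝ) 1, h d
      ≤ ∫⁻ x, ENNReal.ofReal (price x) * h (demand x) ∂μ := by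
  obtain ⟨f, hf, hfL, hcond⟩ := hμ.density
  have hg : Measurable fun z : ℝ × ℝ => ENNReal.ofReal z.1 * h z.2 := by fun_prop
  have hjoint : ∫⁻ x, ENNReal.ofReal (price x) * h (demand x) ∂μ
      = ∫⁻ p, ∫⁻ d, ENNReal.ofReal p * h d ∂(condDistrib demand price μ p) ∂(μ.map price) := by
    rw [← Measure.lintegral_compProd hg, compProd_map_condDistrib measurable_demand.aemeasurable,
      lintegral_map hg (measurable_price.prodMk measurable_demand)]
  rw [hjoint, ← lintegral_map (f := fun p => ENNReal.ofReal p) ENNReal.measurable_ofReal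
    measurable_price, mul_right_comm, mul_comm, ← lintegral_mul_const _ ENNReal.measurable_ofReal]
  refine lintegral_mono_ae ?_
  filter_upwards [hcond, hμ.ae_price_mem] with p hp hp01
  have hfp : Measurable fun d => ENNReal.ofReal (f p d) :=
    (hf.comp measurable_prodMk_left).ennreal_ofReal
  rw [hp, lintegral_const_mul _ hh]
  gcongr
  rw [lintegral_withDensity_eq_lintegral_mul _ hfp hh, ← lintegral_const_mul _ hh]
  refine setLIntegral_mono (hfp.mul hh) fun d hd => ?_
  simp only [Pi.mul_apply]
  gcongr
  exact (hfL p hp01 d hd).le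

theorem Admissible.ae_demand_pos (hμ : Admissible μ L) : ∀ᵐ x ∂μ, 0 < demand x := by
  obtain ⟨f, -, -, hcond⟩ := hμ.density
  have hzero : μ.map demand {0} = 0 := by
    rw [← condDistrib_comp_map measurable_price.aemeasurable measurable_demand.aemeasurable,
      Measure.bind_apply (measurableSet_singleton 0) (Kernel.aemeasurable _),
      lintegral_eq_zero_iff' (Kernel.measurable_coe _ (measurableSet_singleton 0)).aemeasurable]
    filter_upwards [hcond] with p hp
    rw [hp]
    exact withDensity_absolutelyContinuous _ _ (by simp)
  rw [Measure.map_apply measurable_demand (measurableSet_singleton 0)] at hzero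
  have hne : ∀ᵐ x ∂μ, demand x ≠ 0 := measure_eq_zero_iff_ae_notMem.1 hzero
  filter_upwards [hμ.bounded, hne] with x hx hx0
  exact lt_of_le_of_ne hx.2.2.1 (Ne.symm hx0)

theorem Admissible.integrable_cost (hμ : Admissible μ L) : Integrable cost μ :=
  .of_bound measurable_cost.aestronglyMeasurable 1 <| by
    filter_upwards [hμ.bounded] with x hx
    rw [Real.norm_eq_abs, abs_of_nonneg hx.1.1]
    exact hx.1.2

theorem Admissible.integrable_mul_price (hμ : Admissible μ L) {h : ℝ → ℝ} (hh : Measurable h)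
    {B : ℝ} (hB : ∀ d ∈ Icc (0 : ℝ) 1, |h d| ≤ B) :
    Integrable (fun x => h (demand x) * price x) μ :=
  .of_bound ((hh.comp measurable_demand).mul measurable_price).aestronglyMeasurable B <| by
    filter_upwards [hμ.bounded] with x hx
    rw [Real.norm_eq_abs, abs_mul, abs_of_nonneg hx.2.1.1]
    have h1 := hB _ hx.2.2
    have h2 := abs_nonneg (h (demand x))
    nlinarith [hx.2.1.1, hx.2.1.2]

theorem Admissible.integrable_min_mul_price (hμ : Admissible μ L) (q : ℝ) :
    Integrable (fun x => min q (demand x) * price x) μ :=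
  hμ.integrable_mul_price (h := fun d => min q d) (measurable_const.min measurable_id)
    (B := |q| + 1) fun d hd => by
      rw [abs_le]
      refine ⟨le_min ?_ ?_, (min_le_right _ _).trans ?_⟩
      · linarith [neg_abs_le q]
      · linarith [abs_nonneg q, hd.1]
      · linarith [abs_nonneg q, hd.2]

theorem Admissible.integrable_price (hμ : Admissible μ L) : Integrable price μ := by
  simpa using hμ.integrable_mul_price (h := fun _ => 1) measurable_const (B := 1) (by simp)

theorem Admissible.cost_nonneg (hμ : Admissible μ L) : 0 ≤ ∫ x, cost x ∂μ :=
  integral_nonneg_of_ae (hμ.bounded.mono fun _ hx => hx.1.1)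

theorem Admissible.price_le_one (hμ : Admissible μ L) : ∫ x, price x ∂μ ≤ 1 := by
  have := integral_mono_ae hμ.integrable_price (integrable_const (1 : ℝ))
    (hμ.bounded.mono fun _ hx => hx.2.1.2)
  simpa using this

theorem Admissible.price_pos (hμ : Admissible μ L) : 0 < ∫ x, price x ∂μ :=
  hμ.cost_nonneg.trans_lt hμ.cost_lt_price

theorem Admissible.integral_mul_price_ge (hμ : Admissible μ L) {h : ℝ → ℝ} (hh : Continuous h)
    (h0 : ∀ d, 0 ≤ h d) :
    (∫ x, price x ∂μ) * L * ∫ d in (0 : ℝ)..1, h d ≤ ∫ x, h (demand x) * price x ∂μ := by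
  obtain ⟨B, hB⟩ := isCompact_Icc.exists_bound_of_continuousOn (hh.continuousOn (s := Icc 0 1))
  have hint := hμ.integrable_mul_price hh.measurable hB
  have hp0 : ∀ᵐ x ∂μ, 0 ≤ price x := hμ.bounded.mono fun _ hx => hx.2.1.1
  have key := hμ.lintegral_price_mul_ge (h := fun d => ENNReal.ofReal (h d))
    hh.measurable.ennreal_ofReal
  have e1 : ∫⁻ x, ENNReal.ofReal (price x) * ENNReal.ofReal (h (demand x)) ∂μ
      = ENNReal.ofReal (∫ x, h (demand x) * price x ∂μ) := by
    rw [ofReal_integral_eq_lintegral_ofReal hint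
      (hp0.mono fun x hx => mul_nonneg (h0 _) hx)]
    refine lintegral_congr fun x => ?_
    rw [mul_comm, ENNReal.ofReal_mul (h0 _)]
  have e2 : ∫⁻ d in Icc (0 : ℝ) 1, ENNReal.ofReal (h d)
      = ENNReal.ofReal (∫ d in (0 : ℝ)..1, h d) := by
    rw [intervalIntegral.integral_of_le zero_le_one, ← integral_Icc_eq_integral_Ioc,
      ofReal_integral_eq_lintegral_ofReal (hh.continuousOn.integrableOn_Icc)
        (Eventually.of_forall h0)]
  rw [e1, e2, ← ofReal_integral_eq_lintegral_ofReal hμ.integrable_price hp0,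
    ← ENNReal.ofReal_mul hμ.L_pos.le,
    ← ENNReal.ofReal_mul (mul_nonneg hμ.L_pos.le hμ.price_pos.le)] at key
  rw [mul_comm (∫ x, price x ∂μ) L]
  refine (ENNReal.ofReal_le_ofReal_iff ?_).1 key
  exact integral_nonneg_of_ae (hp0.mono fun x hx => mul_nonneg (h0 _) hx)

theorem integral_min_const {q : ℝ} (hq : q ∈ Icc (0 : ℝ) 1) :
    ∫ d in (0 : ℝ)..1, min q d = q - q ^ 2 / 2 := by
  have hc : Continuous fun d : ℝ => min q d := by fun_prop
  rw [← intervalIntegral.integral_add_adjacent_intervals (b := q) (hc.intervalIntegrable _ _)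
    (hc.intervalIntegrable _ _)]
  have h1 : ∫ d in (0 : ℝ)..q, min q d = ∫ d in (0 : ℝ)..q, d :=
    intervalIntegral.integral_congr fun d hd => by
      rw [uIcc_of_le hq.1] at hd; exact min_eq_right hd.2
  have h2 : ∫ d in q..1, min q d = ∫ _ in q..1, q :=
    intervalIntegral.integral_congr fun d hd => by
      rw [uIcc_of_le hq.2] at hd; exact min_eq_left hd.1
  rw [h1, h2, integral_id, intervalIntegral.integral_const, smul_eq_mul]
  ring

/-- The retailer's utility is strongly concave on `[0, 1]` with modulus `E[P] L`. The concavity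
defect of `q ↦ min q d` is nonnegative, and its integral over `d ∈ [0, 1]` is `a b (q - r)² / 2`.
-/
theorem Admissible.uR_strongly_concave (hμ : Admissible μ L) (v : ℝ) {q r a b : ℝ}
    (hq : q ∈ Icc (0 : ℝ) 1) (hr : r ∈ Icc (0 : ℝ) 1) (ha : 0 ≤ a) (hb : 0 ≤ b)
    (hab : a + b = 1) :
    a * uR μ v q + b * uR μ v r + (∫ x, price x ∂μ) * L / 2 * (a * b * (q - r) ^ 2)
      ≤ uR μ v (a * q + b * r) := by
  have hmem : a * q + b * r ∈ Icc (0 : ℝ) 1 := by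
    have := (convex_Icc (0 : ℝ) 1) hq hr ha hb hab
    simpa using this
  have hcont : ∀ u : ℝ, Continuous fun d : ℝ => min u d := fun u => by fun_prop
  have key := hμ.integral_mul_price_ge
    (h := fun d => min (a * q + b * r) d - (a * min q d + b * min r d)) (by fun_prop) (fun d => by
      rw [sub_nonneg]
      refine le_min ?_ ?_
      · nlinarith [min_le_left q d, min_le_left r d]
      · have : d = a * d + b * d := by rw [← add_mul, hab, one_mul]
        nlinarith [min_le_right q d, min_le_right r d])
  have i1 : ∫ d in (0 : ℝ)..1, (min (a * q + b * r) d - (a * min q d + b * min r d))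
      = a * b * (q - r) ^ 2 / 2 := by
    rw [intervalIntegral.integral_sub ((hcont _).intervalIntegrable _ _)
        ((by fun_prop : Continuous fun d : ℝ => a * min q d + b * min r d).intervalIntegrable _ _),
      intervalIntegral.integral_add
        ((by fun_prop : Continuous fun d : ℝ => a * min q d).intervalIntegrable _ _)
        ((by fun_prop : Continuous fun d : ℝ => b * min r d).intervalIntegrable _ _),
      intervalIntegral.integral_const_mul, intervalIntegral.integral_const_mul,
      integral_min_const hmem, integral_min_const hq, integral_min_const hr]
    obtain rfl : b = 1 - a := by linarith
    ring
  have hint : Integrable (fun x => a * (min q (demand x) * price x)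
      + b * (min r (demand x) * price x)) μ :=
    ((hμ.integrable_min_mul_price q).const_mul a).add
      ((hμ.integrable_min_mul_price r).const_mul b)
  have i2 : ∫ x, (min (a * q + b * r) (demand x) - (a * min q (demand x) + b * min r (demand x)))
        * price x ∂μ
      = (∫ x, min (a * q + b * r) (demand x) * price x ∂μ)
        - (a * (∫ x, min q (demand x) * price x ∂μ)
          + b * ∫ x, min r (demand x) * price x ∂μ) := by
    rw [← integral_const_mul, ← integral_const_mul, ← integral_add
      ((hμ.integrable_min_mul_price q).const_mul a) ((hμ.integrable_min_mul_price r).const_mul b),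
      ← integral_sub (hμ.integrable_min_mul_price _) hint]
    refine integral_congr_ae (Eventually.of_forall fun x => ?_)
    simp only []
    ring
  rw [i1, i2] at key
  unfold uR
  linarith

/-- Quadratic growth at a maximiser, obtained from strong concavity on the segment from `q` to `r`
by letting its moving point tend to `q`; the midpoint alone would lose a factor `2` in the
Lipschitz constant of the best response. -/
theorem Admissible.uR_quadratic_growth (hμ : Admissible μ L) {v q r : ℝ}
    (hq : q ∈ Icc (0 : ℝ) 1) (hmax : IsMaxOn (uR μ v) (Icc 0 1) q) (hr : r ∈ Icc (0 : ℝ) 1) :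
    uR μ v r + (∫ x, price x ∂μ) * L / 2 * (q - r) ^ 2 ≤ uR μ v q := by
  set m := (∫ x, price x ∂μ) * L / 2 with hm
  have hstep : ∀ᶠ θ in 𝓝[>] (0 : ℝ), uR μ v r + (1 - θ) * (m * (q - r) ^ 2) ≤ uR μ v q := by
    filter_upwards [Ioo_mem_nhdsGT (zero_lt_one' ℝ)] with θ hθ
    have h1 := hμ.uR_strongly_concave v hq hr (a := 1 - θ) (b := θ) (by linarith [hθ.2]) hθ.1.le
      (by ring)
    have h2 : uR μ v ((1 - θ) * q + θ * r) ≤ uR μ v q := hmax (by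
      simpa using (convex_Icc (0 : ℝ) 1) hq hr (by linarith [hθ.2]) hθ.1.le
        (show (1 - θ) + θ = 1 by ring))
    have h3 : θ * (uR μ v r + (1 - θ) * (m * (q - r) ^ 2)) ≤ θ * uR μ v q := by
      rw [← hm] at h1; linarith
    exact le_of_mul_le_mul_left h3 hθ.1
  have hlim : Tendsto (fun θ : ℝ => uR μ v r + (1 - θ) * (m * (q - r) ^ 2)) (𝓝[>] 0)
      (𝓝 (uR μ v r + (1 - 0) * (m * (q - r) ^ 2))) :=
    Tendsto.mono_left (Continuous.tendsto (by fun_prop) 0) nhdsWithin_le_nhds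
  simpa using le_of_tendsto hlim hstep

/-- Adding the quadratic growth inequalities at two best responses. Uniqueness, monotonicity and
the Lipschitz bound for the best response all follow. -/
theorem Admissible.bestResponse_comonotone (hμ : Admissible μ L) {v v' q q' : ℝ}
    (hq : q ∈ Icc (0 : ℝ) 1) (hmax : IsMaxOn (uR μ v) (Icc 0 1) q)
    (hq' : q' ∈ Icc (0 : ℝ) 1) (hmax' : IsMaxOn (uR μ v') (Icc 0 1) q') :
    (∫ x, price x ∂μ) * L * (q - q') ^ 2 ≤ (q - q') * (v' - v) := by
  have h1 := hμ.uR_quadratic_growth hq hmax hq'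
  have h2 := hμ.uR_quadratic_growth hq' hmax' hq
  unfold uR at h1 h2
  linarith

theorem Admissible.bestResponse_unique (hμ : Admissible μ L) {v q q' : ℝ}
    (hq : q ∈ Icc (0 : ℝ) 1) (hmax : IsMaxOn (uR μ v) (Icc 0 1) q)
    (hq' : q' ∈ Icc (0 : ℝ) 1) (hmax' : IsMaxOn (uR μ v) (Icc 0 1) q') : q = q' := by
  have h := hμ.bestResponse_comonotone hq hmax hq' hmax'
  rw [sub_self, mul_zero] at h
  have hpos : 0 < (∫ x, price x ∂μ) * L := mul_pos hμ.price_pos hμ.L_pos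
  have h2 : (q - q') ^ 2 = 0 := le_antisymm (by
    by_contra! h3
    nlinarith [mul_pos hpos h3]) (sq_nonneg _)
  exact sub_eq_zero.1 (pow_eq_zero_iff two_ne_zero |>.1 h2)

theorem Admissible.bestResponse_antitone (hμ : Admissible μ L) {v v' q q' : ℝ}
    (hq : q ∈ Icc (0 : ℝ) 1) (hmax : IsMaxOn (uR μ v) (Icc 0 1) q)
    (hq' : q' ∈ Icc (0 : ℝ) 1) (hmax' : IsMaxOn (uR μ v') (Icc 0 1) q') (hv : v ≤ v') :
    q' ≤ q := by
  have h := hμ.bestResponse_comonotone hq hmax hq' hmax'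
  have hpos : 0 < (∫ x, price x ∂μ) * L := mul_pos hμ.price_pos hμ.L_pos
  by_contra! hlt
  nlinarith [mul_pos hpos (pow_pos (sub_pos.2 hlt) 2),
    mul_nonneg (sub_nonneg.2 hlt.le) (sub_nonneg.2 hv)]

theorem Admissible.bestResponse_lipschitz (hμ : Admissible μ L) {v v' q q' : ℝ}
    (hq : q ∈ Icc (0 : ℝ) 1) (hmax : IsMaxOn (uR μ v) (Icc 0 1) q)
    (hq' : q' ∈ Icc (0 : ℝ) 1) (hmax' : IsMaxOn (uR μ v') (Icc 0 1) q') :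
    (∫ x, price x ∂μ) * L * |q - q'| ≤ |v - v'| := by
  have h := hμ.bestResponse_comonotone hq hmax hq' hmax'
  rcases eq_or_ne q q' with rfl | hne
  · simp
  · have h0 : 0 < |q - q'| := abs_pos.2 (sub_ne_zero.2 hne)
    refine le_of_mul_le_mul_left ?_ h0
    calc |q - q'| * ((∫ x, price x ∂μ) * L * |q - q'|)
        = (∫ x, price x ∂μ) * L * (q - q') ^ 2 := by rw [← sq_abs (q - q')]; ring
      _ ≤ (q - q') * (v' - v) := h
      _ ≤ |(q - q') * (v' - v)| := le_abs_self _
      _ = |q - q'| * |v - v'| := by rw [abs_mul, abs_sub_comm v']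

/-- Since the demand is at most `1`, ordering more than `1` only adds cost. -/
theorem Admissible.uR_min_one (hμ : Admissible μ L) (v q : ℝ) :
    uR μ v (min q 1) = uR μ v q + (q - min q 1) * v := by
  have : ∫ x, min (min q 1) (demand x) * price x ∂μ = ∫ x, min q (demand x) * price x ∂μ := by
    refine integral_congr_ae ?_
    filter_upwards [hμ.bounded] with x hx
    rw [min_assoc, min_eq_right hx.2.2.2]
  unfold uR
  rw [this]
  ring

theorem Admissible.uR_le (hμ : Admissible μ L) (v q : ℝ) :
    uR μ v q ≤ q * ((∫ x, price x ∂μ) - v) := by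
  have h := integral_mono_ae (hμ.integrable_min_mul_price q) (hμ.integrable_price.const_mul q) (by
    filter_upwards [hμ.bounded] with x hx
    exact mul_le_mul_of_nonneg_right (min_le_left _ _) hx.2.1.1)
  rw [integral_const_mul] at h
  unfold uR
  linarith

theorem Admissible.uR_zero (hμ : Admissible μ L) (v : ℝ) : uR μ v 0 = 0 := by
  have : ∫ x, min 0 (demand x) * price x ∂μ = 0 := by
    refine integral_eq_zero_of_ae ?_
    filter_upwards [hμ.bounded] with x hx
    rw [min_eq_left hx.2.2.1, zero_mul]
    rfl
  rw [uR, this]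
  ring

/-- Below the mean price it is profitable to order a small quantity, since the demand is almost
surely positive: `E[min(q, D) P] / q → E[P]` as `q → 0`. -/
theorem Admissible.exists_uR_pos (hμ : Admissible μ L) {v : ℝ} (hv : v < ∫ x, price x ∂μ) :
    ∃ q, 0 < q ∧ 0 < uR μ v q := by
  have hlim : Tendsto (fun n : ℕ => ∫ x, ((n : ℝ) + 1) * (min (1 / ((n : ℝ) + 1)) (demand x)
      * price x) ∂μ) atTop (𝓝 (∫ x, price x ∂μ)) := by
    refine tendsto_integral_of_dominated_convergence price
      (fun n => ((hμ.integrable_min_mul_price _).const_mul _).aestronglyMeasurable)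
      hμ.integrable_price (fun n => ?_) ?_
    · filter_upwards [hμ.bounded] with x hx
      have hn : (0 : ℝ) < (n : ℝ) + 1 := by positivity
      have hmin : 0 ≤ min (1 / ((n : ℝ) + 1)) (demand x) := le_min (by positivity) hx.2.2.1
      rw [Real.norm_eq_abs, abs_of_nonneg (mul_nonneg hn.le (mul_nonneg hmin hx.2.1.1)),
        ← mul_assoc]
      refine mul_le_of_le_one_left hx.2.1.1 ?_
      calc ((n : ℝ) + 1) * min (1 / ((n : ℝ) + 1)) (demand x)
          ≤ ((n : ℝ) + 1) * (1 / ((n : ℝ) + 1)) := by gcongr; exact min_le_left _ _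
        _ = 1 := by field_simp
    · filter_upwards [hμ.ae_demand_pos] with x hx
      refine tendsto_const_nhds.congr' ?_
      filter_upwards [(tendsto_one_div_add_atTop_nhds_zero_nat (𝕜 := ℝ)).eventually_lt_const hx]
        with n hn
      rw [min_eq_left hn.le]
      field_simp
  obtain ⟨n, hn⟩ := (hlim.eventually_const_lt hv).exists
  have hn0 : (0 : ℝ) < (n : ℝ) + 1 := by positivity
  refine ⟨1 / ((n : ℝ) + 1), by positivity, ?_⟩
  rw [integral_const_mul] at hn
  unfold uR
  refine pos_of_mul_pos_right ?_ hn0.le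
  rw [mul_sub, ← mul_assoc, mul_one_div_cancel hn0.ne']
  linarith

end Game

/-! ### The supplier's objective and the equilibrium -/

section Leader

/-- `qh v` is a best response of the retailer within `[0, 1]` to every wholesale price `v ≥ 0`. -/
def IsBestResponseMap (μ : Measure Outcome) (qh : ℝ → ℝ) : Prop :=
  ∀ v ∈ Ici (0 : ℝ), qh v ∈ Icc (0 : ℝ) 1 ∧ IsMaxOn (uR μ v) (Icc 0 1) (qh v)

/-- The supplier's expected utility at the wholesale price `x` when the retailer orders `qh x`. -/
noncomputable def leaderValue (μ : Measure Outcome) (qh : ℝ → ℝ) (x : ℝ) : ℝ :=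
  qh x * (x - ∫ y, cost y ∂μ)

variable {μ : Measure Outcome} {L : ℝ} {wstar qstar : ℝ} {qh : ℝ → ℝ}

/-- The retailer's optimal value is `1`-Lipschitz in the price, as a maximum of such functions. -/
theorem IsBestResponseMap.continuousOn_followerValue (hqh : IsBestResponseMap μ qh) :
    ContinuousOn (fun x => uR μ x (qh x)) (Icc 0 1) := by
  have hle : ∀ x ∈ Icc (0 : ℝ) 1, ∀ y ∈ Icc (0 : ℝ) 1,
      uR μ x (qh x) - uR μ y (qh y) ≤ |x - y| := by
    intro x hx y hy
    have h1 : uR μ y (qh x) ≤ uR μ y (qh y) := (hqh y hy.1).2 (hqh x hx.1).1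
    have h2 : uR μ x (qh x) = uR μ y (qh x) + qh x * (y - x) := by unfold uR; ring
    have h3 : qh x * (y - x) ≤ |x - y| := by
      rw [abs_sub_comm]
      exact (mul_le_mul_of_nonneg_left (le_abs_self _) (hqh x hx.1).1.1).trans
        (mul_le_of_le_one_left (abs_nonneg _) (hqh x hx.1).1.2)
    linarith
  refine (LipschitzOnWith.of_dist_le_mul (K := 1) fun x hx y hy => ?_).continuousOn
  rw [Real.dist_eq, Real.dist_eq, NNReal.coe_one, one_mul]
  exact abs_sub_le_iff.2 ⟨hle x hx y hy, abs_sub_comm x y ▸ hle y hy x hx⟩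

theorem IsPiyavskiiShubertRun.mem_Icc {c M : ℝ} {T : ℕ} {w q : ℕ → ℝ}
    (hrun : IsPiyavskiiShubertRun c M T w q) {t : ℕ} (ht : t ∈ Finset.Icc 1 T) :
    w t ∈ Icc (0 : ℝ) 1 := by
  rw [Finset.mem_Icc] at ht
  rcases eq_or_ne t 1 with rfl | hne
  · rw [hrun.init]; exact right_mem_Icc.2 zero_le_one
  · obtain ⟨t, rfl⟩ : ∃ u, t = u + 1 := ⟨t - 1, by omega⟩
    exact (hrun.step t (by omega) (by omega)).1

theorem IsPiyavskiiShubertRun.isShubertRun {M : ℝ} {T : ℕ} {w q : ℕ → ℝ}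
    (hrun : IsPiyavskiiShubertRun (∫ x, cost x ∂μ) M T w q)
    (hq : ∀ t ∈ Finset.Icc 1 T, q t = qh (w t)) : IsShubertRun (leaderValue μ qh) M T w := by
  refine ⟨fun t h1 h2 => hrun.mem_Icc (Finset.mem_Icc.2 ⟨h1, h2⟩), fun t h1 h2 x hx a ha => ?_⟩
  have hlt : ∀ y, a < proxy (∫ x, cost x ∂μ) M w q t h1 y ↔
      ∀ s ∈ Finset.Icc 1 t, a < cone (leaderValue μ qh) M (w s) y := by
    intro y
    rw [proxy, Finset.lt_inf'_iff]
    refine forall₂_congr fun s hs => ?_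
    rw [hq s (Finset.Icc_subset_Icc le_rfl h2.le hs), cone, leaderValue]
  exact (hlt _).1 (((hlt x).2 ha).trans_le ((hrun.step t h1 h2).2 hx))

variable [IsProbabilityMeasure μ]

/-- The equilibrium price lies in `(E[C], 1]` and is the unique maximiser of the supplier's value
on `[0, 1]`. At `v = 0` every quantity `≥ 1` is a best response in `[0, ∞)`, so the given
best-response map is truncated at `1`; for `v > 0` the truncation changes nothing. -/
theorem IsStackelberg.exists_bestResponseMap (hμ : Admissible μ L)
    (hstar : IsStackelberg μ (wstar, qstar)) :
    ∃ qh, IsBestResponseMap μ qh ∧ qh wstar = qstar ∧ ∫ x, cost x ∂μ < wstar ∧ wstar ≤ 1 ∧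
      ∀ x ∈ Icc (0 : ℝ) 1, x ≠ wstar → leaderValue μ qh x < leaderValue μ qh wstar := by
  obtain ⟨BR, hBR, hw0, hmax, hqs⟩ := id hstar
  simp only at hw0 hmax hqs
  subst hqs
  set c := ∫ x, cost x ∂μ with hc
  have hc0 : 0 ≤ c := hμ.cost_nonneg
  have hcp := hμ.cost_lt_price
  have hle : ∀ v, 0 < v → BR v ≤ 1 := by
    intro v hv
    have h0 : (0 : ℝ) ≤ BR v := (hBR v hv.le).1
    have h1 : uR μ v (min (BR v) 1) ≤ uR μ v (BR v) :=
      (hBR v hv.le).2 (show (0 : ℝ) ≤ min (BR v) 1 from le_min h0 zero_le_one)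
    rw [hμ.uR_min_one] at h1
    have h2 : (BR v - min (BR v) 1) * v ≤ 0 := by linarith
    by_contra! hlt
    rw [min_eq_right hlt.le] at h2
    nlinarith
  have hval : ∀ v q : ℝ, uS μ v q = q * (v - c) := fun v q => by rw [uS, mul_sub]
  have hpos : 0 < BR wstar * (wstar - c) := by
    have hv0 : (0 : ℝ) ≤ (c + ∫ x, price x ∂μ) / 2 := by linarith [hμ.price_pos]
    obtain ⟨q, hq, huq⟩ := hμ.exists_uR_pos (v := (c + ∫ x, price x ∂μ) / 2) (by linarith)
    have h1 : 0 < uR μ _ (BR ((c + ∫ x, price x ∂μ) / 2)) := huq.trans_le ((hBR _ hv0).2 hq.le)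
    have h2 : 0 < BR ((c + ∫ x, price x ∂μ) / 2) := by
      refine lt_of_le_of_ne (hBR _ hv0).1 fun h0 => ?_
      rw [← h0, hμ.uR_zero] at h1
      exact lt_irrefl _ h1
    have h3 : uS μ _ (BR ((c + ∫ x, price x ∂μ) / 2)) ≤ uS μ wstar (BR wstar) := hmax hv0
    rw [hval, hval] at h3
    exact lt_of_lt_of_le (mul_pos h2 (by linarith)) h3
  have hq0 : 0 < BR wstar := lt_of_le_of_ne (hBR _ hw0).1 fun h0 => by
    rw [← h0, zero_mul] at hpos
    exact lt_irrefl _ hpos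
  have hcw : c < wstar := by linarith [pos_of_mul_pos_right hpos hq0.le]
  have hw1 : wstar ≤ 1 := by
    have h1 : uR μ wstar 0 ≤ uR μ wstar (BR wstar) := (hBR _ hw0).2 (self_mem_Ici)
    rw [hμ.uR_zero] at h1
    have h2 := h1.trans (hμ.uR_le wstar (BR wstar))
    linarith [nonneg_of_mul_nonneg_right h2 hq0, hμ.price_le_one]
  have hqh : ∀ v, 0 < v → min (BR v) 1 = BR v := fun v hv => min_eq_left (hle v hv)
  refine ⟨fun v => min (BR v) 1, ?_, hqh _ (hc0.trans_lt hcw), hcw, hw1, ?_⟩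
  · intro v hv
    have h0 : (0 : ℝ) ≤ BR v := (hBR v hv).1
    refine ⟨⟨le_min h0 zero_le_one, min_le_right _ _⟩, fun q hq => ?_⟩
    have h1 : uR μ v q ≤ uR μ v (BR v) := (hBR v hv).2 hq.1
    have h2 : 0 ≤ (BR v - min (BR v) 1) * v := mul_nonneg (sub_nonneg.2 (min_le_left _ _)) hv
    rw [mem_ofPred_eq, hμ.uR_min_one]
    linarith
  · intro x hx hne
    simp only [leaderValue]
    rw [hqh _ (hc0.trans_lt hcw), ← hc]
    rcases hx.1.eq_or_lt with rfl | hx0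
    · have h0 : (0 : ℝ) ≤ min (BR 0) 1 := le_min (hBR 0 self_mem_Ici).1 zero_le_one
      nlinarith
    · rw [hqh x hx0, ← hval, ← hval]
      refine lt_of_le_of_ne (hmax hx.1) fun heq => hne ?_
      have hx' : IsStackelberg μ (x, BR x) :=
        ⟨BR, hBR, hx.1, fun v hv => (hmax hv).trans heq.ge, rfl⟩
      exact congrArg Prod.fst (hμ.unique_equilibrium.unique hx' hstar)

theorem IsBestResponseMap.continuousOn (hμ : Admissible μ L) (hqh : IsBestResponseMap μ qh) :
    ContinuousOn qh (Icc 0 1) := by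
  have hpos : 0 < (∫ x, price x ∂μ) * L := mul_pos hμ.price_pos hμ.L_pos
  refine (LipschitzOnWith.of_dist_le_mul (K := Real.toNNReal ((∫ x, price x ∂μ) * L)⁻¹)
    fun x hx y hy => ?_).continuousOn
  have := hμ.bestResponse_lipschitz (hqh x hx.1).1 (hqh x hx.1).2 (hqh y hy.1).1 (hqh y hy.1).2
  rw [Real.dist_eq, Real.dist_eq, Real.coe_toNNReal _ (inv_pos.2 hpos).le, ← div_eq_inv_mul,
    le_div_iff₀' hpos]
  exact this

/-- The supplier's value satisfies the one-point cone inequality with the constant `M` of the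
algorithm. For `x < wstar` the retailer orders more at `x` than at `wstar`, so slope `1` suffices;
for `x > wstar` the margin `wstar - E[C]` is at most `1 - E[C]` and the best response is
Lipschitz. -/
theorem IsBestResponseMap.isShubertObjective (hμ : Admissible μ L) (hqh : IsBestResponseMap μ qh)
    (hcw : ∫ x, cost x ∂μ < wstar) (hw1 : wstar ≤ 1)
    (hlt : ∀ x ∈ Icc (0 : ℝ) 1, x ≠ wstar → leaderValue μ qh x < leaderValue μ qh wstar) :
    IsShubertObjective (leaderValue μ qh)
      ((1 - ∫ x, cost x ∂μ) / ((∫ x, price x ∂μ) * L) + 1) wstar := by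
  set c := ∫ x, cost x ∂μ with hc
  have hc0 : 0 ≤ c := hμ.cost_nonneg
  have hpos : 0 < (∫ x, price x ∂μ) * L := mul_pos hμ.price_pos hμ.L_pos
  have hK : 0 < (1 - c) / ((∫ x, price x ∂μ) * L) := div_pos (by linarith) hpos
  have hws : wstar ∈ Ici (0 : ℝ) := hc0.trans hcw.le
  refine ⟨by linarith, ⟨hc0.trans_lt hcw, hw1⟩,
    (hqh.continuousOn hμ).mul (by fun_prop), hlt, fun x hx hne => ?_⟩
  obtain ⟨hqx, hmx⟩ := hqh x hx.1
  obtain ⟨hqs, hms⟩ := hqh wstar hws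
  have hsplit : leaderValue μ qh wstar - leaderValue μ qh x
      = (qh wstar - qh x) * (wstar - c) + qh x * (wstar - x) := by
    simp only [leaderValue, ← hc]; ring
  rw [hsplit]
  rcases lt_or_gt_of_ne hne with hx1 | hx1
  · have h1 := hμ.bestResponse_antitone hqx hmx hqs hms hx1.le
    rw [abs_of_neg (by linarith)]
    nlinarith [hqx.1, hqx.2, mul_nonneg (sub_nonneg.2 h1) (sub_nonneg.2 hcw.le),
      mul_pos hK (sub_pos.2 hx1), mul_nonneg (sub_nonneg.2 hqx.2) (sub_nonneg.2 hx1.le)]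
  · have h1 := hμ.bestResponse_lipschitz hqs hms hqx hmx
    rw [abs_of_neg (sub_neg.2 hx1), ← le_div_iff₀' hpos] at h1
    have h2 : (qh wstar - qh x) * (wstar - c)
        ≤ (1 - c) / ((∫ x, price x ∂μ) * L) * (x - wstar) := by
      calc (qh wstar - qh x) * (wstar - c)
          ≤ (-(wstar - x) / ((∫ x, price x ∂μ) * L)) * (wstar - c) :=
            mul_le_mul_of_nonneg_right ((le_abs_self _).trans h1) (by linarith)
        _ ≤ (-(wstar - x) / ((∫ x, price x ∂μ) * L)) * (1 - c) :=
            mul_le_mul_of_nonneg_left (by linarith) (div_nonneg (by linarith) hpos.le)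
        _ = _ := by ring
    rw [abs_of_pos (by linarith)]
    nlinarith [mul_nonneg hqx.1 (sub_nonneg.2 hx1.le)]

theorem RetailerBestResponds.eq_bestResponseMap (hμ : Admissible μ L)
    (hqh : IsBestResponseMap μ qh) {T : ℕ} {w q : ℕ → ℝ} (hbest : RetailerBestResponds μ T w q)
    {t : ℕ} (ht : t ∈ Finset.Icc 1 T) (hwt : w t ∈ Icc (0 : ℝ) 1) : q t = qh (w t) :=
  hμ.bestResponse_unique (hbest t ht).1 (hbest t ht).2 (hqh _ hwt.1).1 (hqh _ hwt.1).2

theorem integral_sigma (hμ : Admissible μ L) (v q : ℝ) :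
    ∫ x, sigma v q (cost x) ∂μ = q * (v - ∫ x, cost x ∂μ) := by
  simp only [sigma]
  rw [integral_sub (integrable_const _) (hμ.integrable_cost.const_mul q), integral_const_mul q cost]
  simp only [integral_const, probReal_univ, one_smul]
  ring

theorem integral_rho (hμ : Admissible μ L) (v q : ℝ) :
    ∫ x, rho q v (price x) (demand x) ∂μ = uR μ v q := by
  simp only [rho, uR]
  rw [integral_sub (hμ.integrable_min_mul_price q) (integrable_const _)]
  simp

end Leader

end SupplyChain

theorem theorem4
    (μ : Measure SupplyChain.Outcome) [IsProbabilityMeasure μ] (L : ℝ)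
    (hμ : SupplyChain.Admissible μ L)
    -- the i.i.d. sequence of triples `(C_t, P_t, D_t)`
    {Ω : Type*} [MeasurableSpace Ω] (Pr : Measure Ω) [IsProbabilityMeasure Pr]
    (X : ℕ → Ω → SupplyChain.Outcome)
    (hlaw : ∀ t, HasLaw (X t) μ Pr) (hindep : iIndepFun X Pr)
    -- the unique Stackelberg equilibrium of the stage game
    (wstar qstar : ℝ) (hstar : SupplyChain.IsStackelberg μ (wstar, qstar))
    (M : ℝ)
    (hM : M = (1 - ∫ x, SupplyChain.cost x ∂μ) / ((∫ x, SupplyChain.price x ∂μ) * L) + 1)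
    -- `w T` and `q T` are the prices and quantities of the interaction with horizon `T`
    (w q : ℕ → ℕ → ℝ)
    (hrun : ∀ T : ℕ, 1 ≤ T →
      SupplyChain.IsPiyavskiiShubertRun (∫ x, SupplyChain.cost x ∂μ) M T (w T) (q T))
    (hbest : ∀ T : ℕ, 1 ≤ T → SupplyChain.RetailerBestResponds μ T (w T) (q T)) :
    (∀ T : ℕ, 1 ≤ T →
      (∫ x, SupplyChain.sigma wstar qstar (SupplyChain.cost x) ∂μ)
        - (1 / (T : ℝ)) * ∑ t ∈ Finset.Icc 1 T,
            ∫ ω, SupplyChain.sigma (w T t) (q T t) (SupplyChain.cost (X t ω)) ∂Pr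
        ≤ 2 * M * (Real.log (4 * (T : ℝ)) / (T : ℝ))) ∧
    Tendsto (fun T : ℕ =>
      (∫ x, SupplyChain.rho qstar wstar (SupplyChain.price x) (SupplyChain.demand x) ∂μ)
        - (1 / (T : ℝ)) * ∑ t ∈ Finset.Icc 1 T,
            ∫ ω, SupplyChain.rho (q T t) (w T t) (SupplyChain.price (X t ω))
              (SupplyChain.demand (X t ω)) ∂Pr) atTop (𝓝 0) ∧
    Tendsto (fun T : ℕ => |wstar - w T T| + |qstar - q T T|) atTop (𝓝 0) := by
  open SupplyChain in
  obtain ⟨qh, hqh, rfl, hcw, hw1, hmax⟩ := hstar.exists_bestResponseMap hμ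
  have hobj := hqh.isShubertObjective hμ hcw hw1 hmax
  rw [← hM] at hobj
  have hmem : ∀ T, ∀ t ∈ Finset.Icc 1 T, w T t ∈ Icc (0 : ℝ) 1 := fun T t ht =>
    (hrun T ((Finset.mem_Icc.1 ht).1.trans (Finset.mem_Icc.1 ht).2)).mem_Icc ht
  have hq : ∀ T, ∀ t ∈ Finset.Icc 1 T, q T t = qh (w T t) := fun T t ht =>
    (hbest T ((Finset.mem_Icc.1 ht).1.trans (Finset.mem_Icc.1 ht).2)).eq_bestResponseMap hμ hqh ht
      (hmem T t ht)
  have hshubert : ∀ T, 1 ≤ T → IsShubertRun (leaderValue μ qh) M T (w T) := fun T hT =>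
    (hrun T hT).isShubertRun (hq T)
  have hσ : ∀ T, ∀ t ∈ Finset.Icc 1 T,
      ∫ ω, sigma (w T t) (q T t) (cost (X t ω)) ∂Pr = leaderValue μ qh (w T t) := by
    intro T t ht
    have hmeas : Measurable fun x : Outcome => sigma (w T t) (q T t) (cost x) :=
      (measurable_cost.const_mul _).const_sub _
    rw [leaderValue, ← hq T t ht, ← integral_sigma hμ]
    exact (hlaw t).integral_comp hmeas.aestronglyMeasurable
  have hρ : ∀ T, ∀ t ∈ Finset.Icc 1 T,
      ∫ ω, rho (q T t) (w T t) (price (X t ω)) (demand (X t ω)) ∂Pr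
        = uR μ (w T t) (qh (w T t)) := by
    intro T t ht
    have hmeas : Measurable fun x : Outcome => rho (q T t) (w T t) (price x) (demand x) :=
      ((measurable_const.min measurable_demand).mul measurable_price).sub_const _
    rw [← hq T t ht, ← integral_rho hμ]
    exact (hlaw t).integral_comp hmeas.aestronglyMeasurable
  refine ⟨fun T hT => ?_, ?_, ?_⟩
  · have hT0 : (0 : ℝ) < T := by exact_mod_cast hT
    have hsum := (hshubert T hT).sum_gap_le hobj hT
    rw [Finset.sum_sub_distrib, Finset.sum_const, Nat.card_Icc, Nat.add_sub_cancel,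
      nsmul_eq_mul] at hsum
    rw [Finset.sum_congr rfl (hσ T), integral_sigma hμ, ← leaderValue, ← mul_div_assoc,
      le_div_iff₀ hT0]
    refine le_trans (le_of_eq ?_) hsum
    field_simp
  · refine (tendsto_average hobj hshubert hqh.continuousOn_followerValue).congr fun T => ?_
    rw [Finset.sum_congr rfl (hρ T), integral_rho hμ]
  · have hw := tendsto_last_iterate hobj hshubert fun T hT => (hrun T hT).init
    have hws : wstar ∈ Icc (0 : ℝ) 1 := ⟨hobj.xs_mem.1.le, hw1⟩
    have hqT : Tendsto (fun T => q T T) atTop (𝓝 (qh wstar)) := by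
      have hin : ∀ᶠ T in atTop, w T T ∈ Icc (0 : ℝ) 1 := by
        filter_upwards [eventually_ge_atTop 1] with T hT
        exact hmem T T (Finset.mem_Icc.2 ⟨hT, le_rfl⟩)
      refine ((hqh.continuousOn hμ wstar hws).tendsto.comp
        (tendsto_nhdsWithin_iff.2 ⟨hw, hin⟩)).congr' ?_
      filter_upwards [eventually_ge_atTop 1] with T hT
      exact (hq T T (Finset.mem_Icc.2 ⟨hT, le_rfl⟩)).symm
    have h1 := (hw.const_sub wstar).abs
    have h2 := (hqT.const_sub (qh wstar)).abs
    simpa using h1.add h2
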